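/- Let $n$ be an odd positive integer, $q=2^n$, and let $\mathrm{Tr}:\mathbb F_q\to\mathbb F_2$ be the absolute trace. Let $K_n=(\mathbb F_q,+,*)$ be the Knuth binary presemifield, with multiplication \[x*y = xy+\bigl(y\,\mathrm{Tr}(x)+x\,\mathrm{Tr}(y)\bigr)^2 ,\] and let $\Pi(K_n)$ be the projective plane of order $q$ whose points are the affine points $(x,y)$ with $x,y\in\mathbb F_q$, together with the points $(a)$, $a\in\mathbb F_q\cup\{\infty\}$, at infinity, and whose lines are: for $a,b\in\mathbb F_q$, the line $\{(x,y): y=x*a+b\}\cup\{(a)\}$; for $a\in\mathbb F_q$, the line $\{(a,y):y\in\mathbb F_q\}\cup\{(\infty)\}$; and the line at infinity $l_\infty=\{(a): a\in\mathbb F_q\cup\{\infty\}\}$. A hyperoval of $\Pi(K_n)$ is a set of $q+2$ points, no three of which are collinear. A translation hyperoval is a hyperoval that meets $l_\infty$ in exactly two points and for which some group of $q$ translations (collineations fixing every point of $l_\infty$ and fixing every line through some point of $l_\infty$) acts regularly on its $q$ affine points. Let \[\mathcal O_g=\{(y^2+y,\,y): y\in\mathbb F_q\}\cup\{(0),(1)\},\qquad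 \mathcal O_s=\{(x,\,x*x): x\in\mathbb F_q\}\cup\{(0),(\infty)\},\] the latter being the standard hyperoval of $\Pi(K_n)$. Then: 1. $\mathcal O_g$ is a translation hyperoval of $\Pi(K_n)$; 2. if $n\ge 5$, then $\mathcal O_g$ is not equivalent to $\mathcal O_s$, that is, no collineation of $\Pi(K_n)$ maps $\mathcal O_g$ onto $\mathcal O_s$. -/

import Mathlib

/-! ### Presemifields -/

/-- A presemifield multiplication on a nontrivial additive abelian group: all the axioms of a skew
field except associativity and the existence of an identity. -/
structure Presemifield (S : Type*) [AddCommGroup S] [Nontrivial S] where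
  mul : S → S → S
  mul_add : ∀ x y z, mul x (y + z) = mul x y + mul x z
  add_mul : ∀ x y z, mul (x + y) z = mul x z + mul y z
  existsUnique_mul_left : ∀ a b, a ≠ 0 → ∃! x, mul a x = b
  existsUnique_mul_right : ∀ a b, a ≠ 0 → ∃! x, mul x a = b

/-! ### The projective plane of a presemifield -/

namespace Presemifield

open Configuration

variable {S : Type*} [AddCommGroup S] [Nontrivial S]

theorem mul_zero (K : Presemifield S) (x : S) : K.mul x 0 = 0 := by
  have h := K.mul_add x 0 0
  simpa using h

theorem zero_mul (K : Presemifield S) (x : S) : K.mul 0 x = 0 := by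
  have h := K.add_mul 0 0 x
  simpa using h

theorem mul_sub (K : Presemifield S) (x y z : S) : K.mul x (y - z) = K.mul x y - K.mul x z := by
  have h := K.mul_add x (y - z) z
  rw [sub_add_cancel] at h
  rw [h, add_sub_cancel_right]

theorem sub_mul (K : Presemifield S) (x y z : S) : K.mul (x - y) z = K.mul x z - K.mul y z := by
  have h := K.add_mul (x - y) y z
  rw [sub_add_cancel] at h
  rw [h, add_sub_cancel_right]

/-- Points: the affine points `(x, y)`, and the points `(a)` and `(∞)` at infinity. -/
inductive Point (K : Presemifield S) : Type _
  | affine (x y : S)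
  | slope (a : S)
  | infty

/-- Lines: the lines `l_{a,b}`, the lines `l_a` through `(∞)`, and the line `l_∞`. -/
inductive Line (K : Presemifield S) : Type _
  | ordinary (a b : S)
  | vertical (a : S)
  | infty

/-- Incidence. The line `l_{a,b}` consists of the `(x, y)` with `y = x ⋆ a + b`, and of `(a)`;
the line `l_a` consists of the `(a, y)`, and of `(∞)`;
the line `l_∞` consists of all the `(a)`, and of `(∞)`. -/
def Incident (K : Presemifield S) : K.Point → K.Line → Prop
  | .affine x y, .ordinary a b => y = K.mul x a + b
  | .affine x _, .vertical a => x = a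
  | .affine _ _, .infty => False
  | .slope c, .ordinary a _ => c = a
  | .slope _, .vertical _ => False
  | .slope _, .infty => True
  | .infty, .ordinary _ _ => False
  | .infty, .vertical _ => True
  | .infty, .infty => True

instance (K : Presemifield S) : Membership K.Point K.Line := ⟨fun l p => K.Incident p l⟩

theorem mem_def (K : Presemifield S) (p : K.Point) (l : K.Line) : p ∈ l ↔ K.Incident p l := Iff.rfl

theorem eq_of_mul_eq_left (K : Presemifield S) {a x y : S} (ha : a ≠ 0)
    (h : K.mul a x = K.mul a y) : x = y :=
  (K.existsUnique_mul_left a _ ha).unique h rfl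

theorem eq_of_mul_eq_right (K : Presemifield S) {a x y : S} (ha : a ≠ 0)
    (h : K.mul x a = K.mul y a) : x = y :=
  (K.existsUnique_mul_right a _ ha).unique h rfl

theorem eq_or_eq (K : Presemifield S) {p₁ p₂ : K.Point} {l₁ l₂ : K.Line}
    (h₁ : p₁ ∈ l₁) (h₂ : p₂ ∈ l₁) (h₃ : p₁ ∈ l₂) (h₄ : p₂ ∈ l₂) : p₁ = p₂ ∨ l₁ = l₂ := by
  rw [mem_def] at h₁ h₂ h₃ h₄
  rcases p₁ with ⟨x, y⟩ | c | _ <;> rcases p₂ with ⟨x', y'⟩ | c' | _ <;>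
    rcases l₁ with ⟨a, b⟩ | a | _ <;> rcases l₂ with ⟨a', b'⟩ | a' | _ <;>
    simp only [Incident] at h₁ h₂ h₃ h₄ <;> subst_vars <;> try simp
  · -- two affine points on two ordinary lines
    by_cases hx : x = x'
    · left; subst hx; exact ⟨rfl, rfl⟩
    · right
      have ha : a = a' := by
        refine K.eq_of_mul_eq_left (sub_ne_zero.mpr hx) ?_
        rw [K.sub_mul, K.sub_mul]
        have e : K.mul x a - K.mul x' a = (K.mul x a + b) - (K.mul x' a + b) := by abel
        rw [e, h₃, h₄]; abel
      subst ha
      exact ⟨rfl, by simpa using h₃⟩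
  · simpa using h₃
  · simpa using h₄

theorem exists_mem_mem_point (K : Presemifield S) {l₁ l₂ : K.Line} (h : l₁ ≠ l₂) :
    ∃ p : K.Point, p ∈ l₁ ∧ p ∈ l₂ := by
  simp only [mem_def]
  rcases l₁ with ⟨a, b⟩ | a | _ <;> rcases l₂ with ⟨a', b'⟩ | a' | _
  · by_cases ha : a = a'
    · subst ha; exact ⟨.slope a, rfl, rfl⟩
    · obtain ⟨x, hx, -⟩ := K.existsUnique_mul_right (a - a') (b' - b) (sub_ne_zero.mpr ha)
      refine ⟨.affine x (K.mul x a + b), rfl, ?_⟩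
      change K.mul x a + b = K.mul x a' + b'
      rw [K.mul_sub, sub_eq_sub_iff_add_eq_add] at hx
      rw [hx, add_comm]
  · exact ⟨.affine a' (K.mul a' a + b), rfl, rfl⟩
  · exact ⟨.slope a, rfl, trivial⟩
  · exact ⟨.affine a (K.mul a a' + b'), rfl, rfl⟩
  · exact ⟨.infty, trivial, trivial⟩
  · exact ⟨.infty, trivial, trivial⟩
  · exact ⟨.slope a', trivial, rfl⟩
  · exact ⟨.infty, trivial, trivial⟩
  · exact (h rfl).elim

theorem exists_mem_mem_line (K : Presemifield S) {p₁ p₂ : K.Point} (h : p₁ ≠ p₂) :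
    ∃ l : K.Line, p₁ ∈ l ∧ p₂ ∈ l := by
  simp only [mem_def]
  rcases p₁ with ⟨x, y⟩ | c | _ <;> rcases p₂ with ⟨x', y'⟩ | c' | _
  · by_cases hx : x = x'
    · subst hx; exact ⟨.vertical x, rfl, rfl⟩
    · obtain ⟨a, ha, -⟩ := K.existsUnique_mul_left (x - x') (y - y') (sub_ne_zero.mpr hx)
      refine ⟨.ordinary a (y - K.mul x a), (add_sub_cancel _ _).symm, ?_⟩
      change y' = K.mul x' a + (y - K.mul x a)
      rw [K.sub_mul] at ha
      have e : K.mul x' a + (y - K.mul x a) = y - (K.mul x a - K.mul x' a) := by abel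
      rw [e, ha]; abel
  · exact ⟨.ordinary c' (y - K.mul x c'), (add_sub_cancel _ _).symm, rfl⟩
  · exact ⟨.vertical x, rfl, trivial⟩
  · exact ⟨.ordinary c (y' - K.mul x' c), rfl, (add_sub_cancel _ _).symm⟩
  · exact ⟨.infty, trivial, trivial⟩
  · exact ⟨.infty, trivial, trivial⟩
  · exact ⟨.vertical x', trivial, rfl⟩
  · exact ⟨.infty, trivial, trivial⟩
  · exact (h rfl).elim

/-- The points and lines above form a projective plane, the presemifield plane `Π(K)`. -/
noncomputable instance (K : Presemifield S) : ProjectivePlane K.Point K.Line where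
  exists_point := by
    obtain ⟨u, hu⟩ := exists_ne (0 : S)
    rintro (⟨a, b⟩ | a | _)
    · exact ⟨.infty, id⟩
    · exact ⟨.slope 0, id⟩
    · exact ⟨.affine 0 0, id⟩
  exists_line := by
    obtain ⟨u, hu⟩ := exists_ne (0 : S)
    rintro (⟨x, y⟩ | c | _)
    · exact ⟨.infty, id⟩
    · exact ⟨.vertical 0, id⟩
    · exact ⟨.ordinary 0 0, id⟩
  eq_or_eq := K.eq_or_eq
  mkPoint h := (K.exists_mem_mem_point h).choose
  mkPoint_ax h := (K.exists_mem_mem_point h).choose_spec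
  mkLine h := (K.exists_mem_mem_line h).choose
  mkLine_ax h := (K.exists_mem_mem_line h).choose_spec
  exists_config := by
    obtain ⟨u, hu⟩ := exists_ne (0 : S)
    exact ⟨.affine 0 0, .infty, .slope u, .ordinary 0 0, .infty, .vertical u,
      id, fun h => hu (Eq.symm h), id, trivial, trivial, hu, trivial, id⟩

end Presemifield

/-! ### Collineations, translations and hyperovals -/

namespace Configuration

/-- The group of collineations, as permutations of the points: a permutation `σ` such that `σ` and
its inverse map lines onto lines. -/
def collineationGroup (P L : Type*) [Membership P L] : Subgroup (Equiv.Perm P) where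
  carrier := {σ | (∀ l : L, ∃ m : L, ∀ p, σ p ∈ m ↔ p ∈ l) ∧
    (∀ l : L, ∃ m : L, ∀ p, σ⁻¹ p ∈ m ↔ p ∈ l)}
  one_mem' := ⟨fun l => ⟨l, fun _ => Iff.rfl⟩, fun l => ⟨l, fun _ => by simp⟩⟩
  inv_mem' := fun h => ⟨h.2, by simpa using h.1⟩
  mul_mem' := by
    rintro σ τ ⟨h₁, h₂⟩ ⟨h₃, h₄⟩
    refine ⟨fun l => ?_, fun l => ?_⟩
    · obtain ⟨m, hm⟩ := h₃ l
      obtain ⟨k, hk⟩ := h₁ m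
      exact ⟨k, fun p => (hk _).trans (hm p)⟩
    · obtain ⟨m, hm⟩ := h₂ l
      obtain ⟨k, hk⟩ := h₄ m
      refine ⟨k, fun p => ?_⟩
      rw [mul_inv_rev]
      exact (hk _).trans (hm p)

/-- A translation with respect to the line `l`: a collineation that fixes every point of `l`, and
fixes every line through some point `c` of `l`. -/
def IsTranslation {P L : Type*} [Membership P L] (l : L) (σ : Equiv.Perm P) : Prop :=
  σ ∈ collineationGroup P L ∧ (∀ p ∈ l, σ p = p) ∧
    ∃ c ∈ l, ∀ m : L, c ∈ m → ∀ p, σ p ∈ m ↔ p ∈ m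

variable (L : Type*) {P : Type*} [Membership P L]

/-- A hyperoval of a projective plane of order `q`: a set of `q + 2` points, no three of which are
collinear. -/
def IsHyperoval [ProjectivePlane P L] (O : Set P) : Prop :=
  O.ncard = ProjectivePlane.order P L + 2 ∧
    ∀ p₁ ∈ O, ∀ p₂ ∈ O, ∀ p₃ ∈ O, p₁ ≠ p₂ → p₁ ≠ p₃ → p₂ ≠ p₃ →
      ¬ ∃ l : L, p₁ ∈ l ∧ p₂ ∈ l ∧ p₃ ∈ l

variable {L}

/-- A translation hyperoval of a plane of order `q` with translation line `l`: a hyperoval to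
which `l` is secant, such that some group of `q` translations acts regularly on the set of those
points of the hyperoval that are not on `l`. -/
def IsTranslationHyperoval [ProjectivePlane P L] (l : L) (O : Set P) : Prop :=
  IsHyperoval L O ∧ {p ∈ O | p ∈ l}.ncard = 2 ∧
    ∃ G : Subgroup (Equiv.Perm P), (∀ σ ∈ G, IsTranslation l σ) ∧
      Nat.card G = ProjectivePlane.order P L ∧
      (∀ σ ∈ G, ∀ p ∈ O, p ∉ l → σ p ∈ O ∧ σ p ∉ l) ∧
      ∀ p ∈ O, p ∉ l → ∀ p' ∈ O, p' ∉ l → ∃! σ : Equiv.Perm P, σ ∈ G ∧ σ p = p'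

variable (L) in
/-- Two sets of points are equivalent if some collineation maps one onto the other. -/
def AreEquivalent (O₁ O₂ : Set P) : Prop :=
  ∃ φ ∈ collineationGroup P L, φ '' O₁ = O₂

end Configuration

/-! ### The Knuth binary presemifield and two point sets in its plane -/

namespace KnuthBinary

variable (F : Type*) [Field F] [Algebra (ZMod 2) F]

variable {F} in
/-- The absolute trace, with its value regarded as an element of `F`. -/
noncomputable def tr (x : F) : F := algebraMap (ZMod 2) F (Algebra.trace (ZMod 2) F x)

variable {F} in
/-- The multiplication `x * y := xy + (y Tr(x) + x Tr(y))²`. -/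
noncomputable def mul (x y : F) : F := x * y + (y * tr x + x * tr y) ^ 2

theorem charP_two : CharP F 2 := charP_of_injective_algebraMap (algebraMap (ZMod 2) F).injective 2

variable {F}

theorem tr_add (x y : F) : tr (x + y) = tr x + tr y := by simp [tr]

theorem tr_eq (x : F) : tr x = 0 ∨ tr x = 1 := by
  have h : ∀ a : ZMod 2, a = 0 ∨ a = 1 := by decide
  rcases h (Algebra.trace (ZMod 2) F x) with h | h <;> simp [tr, h]

theorem tr_sq [Finite F] (x : F) : tr (x ^ 2) = tr x := by
  have h := Algebra.trace_eq_of_algEquiv (FiniteField.frobeniusAlgEquivOfAlgebraic (ZMod 2) F) x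
  simp only [FiniteField.coe_frobeniusAlgEquivOfAlgebraic, ZMod.card] at h
  rw [tr, h, tr]

theorem tr_one [Finite F] (n : ℕ) (hn : Odd n) (hF : Nat.card F = 2 ^ n) : tr (1 : F) = 1 := by
  have h1 : Module.finrank (ZMod 2) F = n := by
    have h2 := Module.natCard_eq_pow_finrank (K := ZMod 2) (V := F)
    rw [hF, Nat.card_zmod] at h2
    exact (Nat.pow_right_injective le_rfl h2).symm
  have h3 := Algebra.trace_algebraMap (R := ZMod 2) (S := F) 1
  rw [map_one, h1] at h3
  obtain ⟨k, rfl⟩ := hn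
  rw [tr, h3]
  simp [show (2 : ZMod 2) = 0 from rfl]

theorem mul_comm (x y : F) : mul x y = mul y x := by
  unfold mul; ring

theorem mul_add (x y z : F) : mul x (y + z) = mul x y + mul x z := by
  have := charP_two F
  have h : ∀ u v : F, (u + v) ^ 2 = u ^ 2 + v ^ 2 := fun u v => add_pow_char u v 2
  unfold mul
  rw [tr_add]
  simp only [_root_.mul_add, _root_.add_mul, h]
  ring

theorem eq_zero_of_mul_eq_zero [Finite F] (n : ℕ) (hn : Odd n) (hF : Nat.card F = 2 ^ n) {x y : F}
    (hx : x ≠ 0) (h : mul x y = 0) : y = 0 := by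
  by_contra hy
  have := charP_two F
  have h2 : (2 : F) = 0 := CharTwo.two_eq_zero
  unfold mul at h
  rcases tr_eq x with ha | ha <;> rcases tr_eq y with hb | hb <;> rw [ha, hb] at h
  · have : x * y = 0 := by linear_combination h
    simp_all
  · have h' : x * (y + x) = 0 := by linear_combination h
    have h'' : x = y := by
      rw [← sub_eq_zero]
      linear_combination (mul_eq_zero.mp h').resolve_left hx - y * h2
    subst h''
    exact zero_ne_one (ha.symm.trans hb)
  · have h' : y * (y + x) = 0 := by linear_combination h
    have h'' : x = y := by
      rw [← sub_eq_zero]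
      linear_combination (mul_eq_zero.mp h').resolve_left hy - y * h2
    subst h''
    exact zero_ne_one (hb.symm.trans ha)
  · have h' : (x / y) ^ 2 + x / y = 1 := by
      field_simp
      linear_combination h - (x * y + y ^ 2) * h2
    have h3 := congrArg tr h'
    rw [tr_add, tr_sq, tr_one n hn hF] at h3
    exact zero_ne_one (by linear_combination h3 - tr (x / y) * h2)

/-- The left multiplications of the Knuth presemifield are bijective. -/
theorem existsUnique [Finite F] (n : ℕ) (hn : Odd n) (hF : Nat.card F = 2 ^ n) (a b : F) (ha : a ≠ 0) :
    ∃! x, mul a x = b := by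
  let f : F →+ F := AddMonoidHom.mk' (mul a) (mul_add a)
  have hf : Function.Injective f := (injective_iff_map_eq_zero f).mpr
    fun y hy => eq_zero_of_mul_eq_zero n hn hF ha hy
  exact (Finite.injective_iff_bijective.mp hf).existsUnique b

/-- The Knuth binary presemifield on a field `F` with `2 ^ n` elements, `n` odd. -/
noncomputable def presemifield (F : Type*) [Field F] [Finite F] [Algebra (ZMod 2) F]
    (n : ℕ) (hn : Odd n) (hF : Nat.card F = 2 ^ n) : Presemifield F where
  mul := mul
  mul_add := mul_add
  add_mul x y z := by rw [mul_comm, mul_add, mul_comm z x, mul_comm z y]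
  existsUnique_mul_left := existsUnique n hn hF
  existsUnique_mul_right a b ha := by
    simpa only [mul_comm _ a] using existsUnique n hn hF a b ha

end KnuthBinary

/-- The set `{(y² + y, y) : y ∈ F} ∪ {(0), (1)}` in the plane of a presemifield on a field `F`. -/
def quadraticSet {F : Type*} [Field F] (K : Presemifield F) : Set K.Point :=
  Set.range (fun y : F => Presemifield.Point.affine (y ^ 2 + y) y) ∪ {.slope 0, .slope 1}

/-- The standard hyperoval `{(x, x ⋆ x) : x ∈ F} ∪ {(0), (∞)}` in the plane of a commutative
presemifield. -/
def standardHyperoval {S : Type*} [AddCommGroup S] [Nontrivial S] (K : Presemifield S) :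
    Set K.Point :=
  Set.range (fun x : S => Presemifield.Point.affine x (K.mul x x)) ∪ {.slope 0, .infty}

/-!
A hyperoval in the plane of the Knuth binary presemifield, not equivalent to the standard one.

**The hyperoval.** As `Tr(y² + y) = 0`, multiplication by `y² + y` is given by
`(y² + y) * a = (y² + y) a + (y² + y)² Tr(a)`. The set `{(y² + y, y)}` is an additive group, so its
points on a line form a coset of a group, namely, for the lines `y = x * a + b`, the kernel of
`u ↦ (u² + u) * a - u`. The point is that this kernel has at most two elements
(`eq_of_mul_sq_add_self_eq`), and only one if `a` is `0` or `1`, where the line already contains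
the point `(0)` or `(1)`. The translations by the vectors `(t² + t, t)` act regularly on the affine
points.

**Inequivalence.** The point `(∞)` is on the standard hyperoval and not on the other one, so it
suffices that every collineation fixes `(∞)` (`apply_infty_eq`). The plane is `((∞), l)`-transitive
for every line `l` through `(∞)`. A collineation that moves `(∞)`, followed by a translation or a
shear, takes `(∞)` to `(0, 0)` or to `(0)`, and so makes the plane transitive for the flag
`((0, 0), x = 0)` or `((0), y = 0)`. In both cases, following a few points under one elation with
that centre and axis shows that for nonzero `a ≠ b` the map `L_a⁻¹ + L_b⁻¹` is the inverse of some
`L_c`, where `L_a` is the multiplication by `a` (`Presemifield.exists_mul_of_apply_infty_ne`). In the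
Knuth presemifield this fails if `Tr(a) = Tr(b) = 0` (`not_exists_mul_add_eq`): there `L_a` is the
field multiplication by `a` up to rank one, which pins down `c` on a subspace of codimension two,
and then the rank one parts do not match.
-/

namespace Configuration

/-! ### Elations and transitive flags -/

/-- An elation with centre `c` and axis `l` (the condition `c ∈ l` is not built in): a collineation
that fixes every point of `l` and every line through `c`. -/
structure IsElation {P L : Type*} [Membership P L] (c : P) (l : L) (σ : Equiv.Perm P) : Prop where
  mem_collineationGroup : σ ∈ collineationGroup P L
  apply_eq : ∀ p ∈ l, σ p = p
  apply_mem_iff : ∀ m : L, c ∈ m → ∀ p, σ p ∈ m ↔ p ∈ m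

/-- The plane is `(c, l)`-transitive: the elations with centre `c` and axis `l` carry any point off
`l` to any other point off `l` that lies on the same line through `c`. -/
def IsTransitiveFlag {P L : Type*} [Membership P L] (c : P) (l : L) : Prop :=
  ∀ p p' : P, p ∉ l → p' ∉ l → ∀ m : L, c ∈ m → p ∈ m → p' ∈ m → ∃ σ, IsElation c l σ ∧ σ p = p'

/-- Collineations carry transitive flags to transitive flags, by conjugating the elations. -/
theorem IsTransitiveFlag.map {P L : Type*} [Membership P L] {c : P} {l l' : L}
    (h : IsTransitiveFlag c l) {φ : Equiv.Perm P} (hφ : φ ∈ collineationGroup P L)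
    (hl : ∀ p, φ p ∈ l' ↔ p ∈ l) : IsTransitiveFlag (φ c) l' := by
  intro p p' hp hp' m hc hpm hpm'
  have hinv : ∀ (k : L) (q : P), φ q ∈ k ↔ q ∈ (hφ.2 k).choose := fun k q => by
    simpa using ((hφ.2 k).choose_spec (φ q)).symm
  have hmem : ∀ (k : L) (q : P), φ⁻¹ q ∈ (hφ.2 k).choose ↔ q ∈ k := fun k q =>
    (hφ.2 k).choose_spec q
  have hl' : ∀ q, φ⁻¹ q ∈ l ↔ q ∈ l' := fun q => by simpa using (hl (φ⁻¹ q)).symm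
  obtain ⟨σ, hσ, hσp⟩ := h (φ⁻¹ p) (φ⁻¹ p') (by rwa [hl']) (by rwa [hl']) _
    ((hinv m c).mp hc) ((hmem m p).mpr hpm) ((hmem m p').mpr hpm')
  refine ⟨φ * σ * φ⁻¹, ⟨mul_mem (mul_mem hφ hσ.1) (inv_mem hφ), fun q hq => ?_,
    fun k hk q => ?_⟩, ?_⟩
  · rw [Equiv.Perm.mul_apply, Equiv.Perm.mul_apply, hσ.2 _ ((hl' q).mpr hq)]
    exact φ.apply_symm_apply q
  · rw [Equiv.Perm.mul_apply, Equiv.Perm.mul_apply, hinv,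
      hσ.3 _ ((hinv k c).mp hk), hmem]
  · rw [Equiv.Perm.mul_apply, Equiv.Perm.mul_apply, hσp]
    exact φ.apply_symm_apply p'

end Configuration

namespace Presemifield

open Configuration

variable {S : Type*} [AddCommGroup S] [Nontrivial S]

/-! ### Translations and shears of a presemifield plane -/

theorem mul_neg (K : Presemifield S) (x y : S) : K.mul x (-y) = -K.mul x y := by
  simpa [K.mul_zero] using K.mul_sub x 0 y

theorem neg_mul (K : Presemifield S) (x y : S) : K.mul (-x) y = -K.mul x y := by
  simpa [K.zero_mul] using K.sub_mul 0 x y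

/-- The permutation `(x, y) ↦ (x + u, y + x ⋆ a + v)` of the affine points, extended by
`(m) ↦ (m + a)` and `(∞) ↦ (∞)`: a shear followed by a translation. -/
def shearTranslation (K : Presemifield S) (u v a : S) : Equiv.Perm K.Point where
  toFun
    | .affine x y => .affine (x + u) (y + K.mul x a + v)
    | .slope m => .slope (m + a)
    | .infty => .infty
  invFun
    | .affine x y => .affine (x - u) (y - v - K.mul (x - u) a)
    | .slope m => .slope (m - a)
    | .infty => .infty
  left_inv := by rintro (⟨x, y⟩ | m | _) <;> simp
  right_inv := by rintro (⟨x, y⟩ | m | _) <;> simp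

@[simp]
theorem shearTranslation_affine (K : Presemifield S) (u v a x y : S) :
    K.shearTranslation u v a (.affine x y) = .affine (x + u) (y + K.mul x a + v) := rfl

@[simp]
theorem shearTranslation_slope (K : Presemifield S) (u v a m : S) :
    K.shearTranslation u v a (.slope m) = .slope (m + a) := rfl

@[simp]
theorem shearTranslation_infty (K : Presemifield S) (u v a : S) :
    K.shearTranslation u v a .infty = .infty := rfl

theorem shearTranslation_inv (K : Presemifield S) (u v a : S) :
    (K.shearTranslation u v a)⁻¹ = K.shearTranslation (-u) (K.mul u a - v) (-a) := by
  rw [inv_eq_iff_mul_eq_one]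
  ext p
  rcases p with ⟨x, y⟩ | m | _
  · simp only [Equiv.Perm.mul_apply, shearTranslation_affine, Equiv.Perm.one_apply, K.mul_neg,
      Point.affine.injEq, K.add_mul, K.neg_mul]
    constructor <;> abel
  · simp [Equiv.Perm.mul_apply]
  · simp [Equiv.Perm.mul_apply]

theorem exists_forall_shearTranslation_mem_iff (K : Presemifield S) (u v a : S) (l : K.Line) :
    ∃ m : K.Line, ∀ p, K.shearTranslation u v a p ∈ m ↔ p ∈ l := by
  rcases l with ⟨k, b⟩ | c | _
  · refine ⟨.ordinary (k + a) (b + v - K.mul u (k + a)), ?_⟩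
    rintro (⟨x, y⟩ | m | _)
    · simp only [mem_def, Incident, shearTranslation_affine, K.add_mul, K.mul_add]
      rw [← sub_eq_zero, ← sub_eq_zero (a := y)]
      refine Eq.congr ?_ rfl
      abel
    · simp [mem_def, Incident]
    · simp [mem_def, Incident]
  · refine ⟨.vertical (c + u), ?_⟩
    rintro (⟨x, y⟩ | m | _) <;> simp [mem_def, Incident]
  · refine ⟨.infty, ?_⟩
    rintro (⟨x, y⟩ | m | _) <;> simp [mem_def, Incident]

theorem shearTranslation_mem_collineationGroup (K : Presemifield S) (u v a : S) :
    K.shearTranslation u v a ∈ collineationGroup K.Point K.Line := by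
  refine ⟨K.exists_forall_shearTranslation_mem_iff u v a, ?_⟩
  rw [shearTranslation_inv]
  exact K.exists_forall_shearTranslation_mem_iff _ _ _

/-- The centre of the translation by `(u, v)` is the point at infinity of the line that joins
`(0, 0)` to `(u, v)`. -/
theorem isTranslation_shearTranslation (K : Presemifield S) (u v : S) :
    IsTranslation (Line.infty : K.Line) (K.shearTranslation u v 0) := by
  refine ⟨K.shearTranslation_mem_collineationGroup u v 0, ?_, ?_⟩
  · rintro (⟨x, y⟩ | m | _) h
    · exact h.elim
    · simp
    · simp
  · by_cases hu : u = 0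
    · subst hu
      refine ⟨.infty, trivial, ?_⟩
      rintro (⟨k, b⟩ | c | _) hm (⟨x, y⟩ | m | _) <;> simp_all [mem_def, Incident]
    · obtain ⟨s, hs, -⟩ := K.existsUnique_mul_left u v hu
      refine ⟨.slope s, trivial, ?_⟩
      rintro (⟨k, b⟩ | c | _) hm (⟨x, y⟩ | m | _) <;>
        simp_all [mem_def, Incident, K.mul_zero, K.add_mul]
      rw [add_right_comm, add_left_inj]

/-- A presemifield plane is `((∞), l)`-transitive for each line `l` through `(∞)`: the elations
are shears if `l` is a vertical line, and translations if `l` is the line at infinity. -/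
theorem isTransitiveFlag_infty (K : Presemifield S) (l : K.Line) (hl : (Point.infty : K.Point) ∈ l) :
    IsTransitiveFlag (Point.infty : K.Point) l := by
  intro p p' hp hp' m hm hpm hpm'
  rcases l with ⟨k, b⟩ | c | _
  · exact hl.elim
  · -- the shear `(x, y) ↦ (x, y + (x - c) ⋆ a)`
    have key : ∀ a, IsElation (Point.infty : K.Point) (Line.vertical c : K.Line)
        (K.shearTranslation 0 (-K.mul c a) a) := by
      refine fun a => ⟨K.shearTranslation_mem_collineationGroup _ _ _, ?_, ?_⟩
      · rintro (⟨x, y⟩ | m | _) h <;> simp_all [mem_def, Incident]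
      · rintro (⟨k, b⟩ | d | _) h (⟨x, y⟩ | m | _) <;> simp_all [mem_def, Incident]
    rcases p with ⟨x, y⟩ | s | _ <;> rcases p' with ⟨x', y'⟩ | s' | _ <;>
      rcases m with ⟨k, b⟩ | d | _ <;> simp_all only [mem_def, Incident]
    · obtain ⟨a, ha, -⟩ := K.existsUnique_mul_left (d - c) (y' - y) (sub_ne_zero.mpr hp)
      refine ⟨_, key a, ?_⟩
      rw [K.sub_mul] at ha
      simp only [shearTranslation_affine, add_zero, Point.affine.injEq, true_and]
      rw [← sub_eq_zero, ← sub_eq_zero.mpr ha]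
      abel
    · exact ⟨_, key (s' - s), by simp⟩
  · have key : ∀ v, IsElation (Point.infty : K.Point) (Line.infty : K.Line)
        (K.shearTranslation 0 v 0) := by
      refine fun v => ⟨K.shearTranslation_mem_collineationGroup _ _ _, ?_, ?_⟩
      · rintro (⟨x, y⟩ | m | _) h <;> simp_all [mem_def, Incident]
      · rintro (⟨k, b⟩ | d | _) h (⟨x, y⟩ | m | _) <;> simp_all [mem_def, Incident]
    rcases p with ⟨x, y⟩ | s | _ <;> rcases p' with ⟨x', y'⟩ | s' | _ <;>
      rcases m with ⟨k, b⟩ | d | _ <;> simp_all only [mem_def, Incident, not_true_eq_false]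
    exact ⟨_, key (y' - y), by simp [K.mul_zero]⟩

/-! ### Transitive flags that do not come from the construction of the plane -/

/-- If the plane is `((0, 0), x = 0)`-transitive, then for `a ≠ 0`, `b ≠ 0`, `a + b ≠ 0` the map
`L_a⁻¹ + L_b⁻¹` is the inverse `L_c⁻¹` of a left multiplication. The elation used takes the line at infinity to the line `x = b`, and the line
`x = a` to the line `x = c`. -/
theorem exists_mul_left_of_isTransitiveFlag (K : Presemifield S)
    (h : IsTransitiveFlag (.affine 0 0 : K.Point) (.vertical 0 : K.Line)) {a b : S}
    (hb : b ≠ 0) (hab : a + b ≠ 0) :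
    ∃ c, ∀ y s t, K.mul a s = y → K.mul b t = y → K.mul c (s + t) = y := by
  obtain ⟨σ, ⟨hσ, hfix, hcen⟩, hσ0⟩ := h (.slope 0) (.affine b 0) id hb (.ordinary 0 0)
    (by simp [mem_def, Incident, K.mul_zero]) rfl (by simp [mem_def, Incident, K.mul_zero])
  have hray : ∀ s p, σ p ∈ (Line.ordinary s 0 : K.Line) ↔ p ∈ (Line.ordinary s 0 : K.Line) :=
    fun s p => hcen _ (by simp [mem_def, Incident, K.zero_mul]) p
  have hinf : σ .infty = .infty := hfix _ trivial
  have hax : ∀ y, σ (.affine 0 y) = .affine 0 y := fun y => hfix _ rfl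
  obtain ⟨m, hm⟩ := hσ.1 (.vertical a)
  have hm_inf : (.infty : K.Point) ∈ m := by rw [← hinf, hm]; trivial
  -- the image of the point `(a, a ⋆ s)` lies on the image of `x = a`, and on `y = x ⋆ s`
  have h1 : ∀ s, σ (.affine a (K.mul a s)) ∈ m := fun s => (hm _).mpr rfl
  have h2 : ∀ s, σ (.affine a (K.mul a s)) ∈ (Line.ordinary s 0 : K.Line) := fun s =>
    (hray s _).mpr (by simp [mem_def, Incident])
  -- the images of `(0, y)`, `(a, y)` and `(0)`
  have h3 : ∀ y, ∃ k : K.Line, .affine 0 y ∈ k ∧ σ (.affine a y) ∈ k ∧ .affine b 0 ∈ k := by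
    intro y
    obtain ⟨k, hk⟩ := hσ.1 (.ordinary 0 y)
    refine ⟨k, ?_, ?_, ?_⟩
    · rw [← hax, hk]; simp [mem_def, Incident, K.mul_zero]
    · rw [hk]; simp [mem_def, Incident, K.mul_zero]
    · rw [← hσ0, hk]; rfl
  rcases m with ⟨k, d⟩ | c | _
  · exact hm_inf.elim
  · refine ⟨c, ?_⟩
    rintro y s t rfl ht
    have e : σ (.affine a (K.mul a s)) = .affine c (K.mul c s) := by
      have h1 := h1 s
      have h2 := h2 s
      generalize σ (.affine a (K.mul a s)) = q at h1 h2 ⊢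
      rcases q with ⟨x, y⟩ | m | _ <;> simp_all [mem_def, Incident]
    obtain ⟨k, hk1, hk2, hk3⟩ := h3 (K.mul a s)
    rw [e] at hk2
    rcases k with ⟨k, d⟩ | d | _
    · simp only [mem_def, Incident, K.zero_mul, zero_add] at hk1 hk2 hk3
      have e2 : t = -k := by
        refine K.eq_of_mul_eq_left hb ?_
        rw [ht, K.mul_neg, hk1]
        exact (neg_eq_of_add_eq_zero_right hk3.symm).symm
      rw [e2, K.mul_add, K.mul_neg, hk2, hk1]
      abel
    · simp only [mem_def, Incident] at hk1 hk3
      exact (hb (hk3.trans hk1.symm)).elim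
    · exact hk1.elim
  · -- if `x = a` goes to the line at infinity, then `b ⋆ s = -(a ⋆ s)` for all `s`
    exfalso
    obtain ⟨s, hs⟩ := exists_ne (0 : S)
    have e : σ (.affine a (K.mul a s)) = .slope s := by
      have h1 := h1 s
      have h2 := h2 s
      generalize σ (.affine a (K.mul a s)) = q at h1 h2 ⊢
      rcases q with ⟨x, y⟩ | m | _ <;> simp_all [mem_def, Incident]
    obtain ⟨k, hk1, hk2, hk3⟩ := h3 (K.mul a s)
    rw [e] at hk2
    rcases k with ⟨k, d⟩ | d | _
    · simp only [mem_def, Incident, K.zero_mul, zero_add] at hk1 hk2 hk3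
      subst hk2
      refine hab (K.eq_of_mul_eq_right hs ?_)
      rw [K.add_mul, K.zero_mul, hk1, add_comm, ← hk3]
    · exact hk2.elim
    · exact hk1.elim

/-- If the plane is `((0), y = 0)`-transitive, then for `a ≠ 0`, `b ≠ 0`, `a + b ≠ 0` the map
`R_a⁻¹ + R_b⁻¹` is the inverse `R_c⁻¹` of a right multiplication. The elation used takes `(∞)` to `(b)`, and `(a)` to `(c)`. -/
theorem exists_mul_right_of_isTransitiveFlag (K : Presemifield S)
    (h : IsTransitiveFlag (.slope 0 : K.Point) (.ordinary 0 0 : K.Line)) {a b : S}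
    (hb : b ≠ 0) (hab : a + b ≠ 0) :
    ∃ c, ∀ y s t, K.mul s a = y → K.mul t b = y → K.mul (s + t) c = y := by
  obtain ⟨σ, ⟨hσ, hfix, hcen⟩, hσ0⟩ := h .infty (.slope b) id hb .infty trivial trivial trivial
  have hrow : ∀ y p, σ p ∈ (Line.ordinary 0 y : K.Line) ↔ p ∈ (Line.ordinary 0 y : K.Line) :=
    fun y p => hcen _ rfl p
  have hax : ∀ x, σ (.affine x 0) = .affine x 0 := fun x =>
    hfix _ (by simp [mem_def, Incident, K.mul_zero])
  -- the image of the line `x = s` is `y = (x - s) ⋆ b`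
  have key : ∀ s t, K.mul s a = K.mul t b →
      σ (.affine s (K.mul s a)) = .affine (s + t) (K.mul s a) := by
    intro s t hst
    have h1 : σ (.affine s (K.mul s a)) ∈ (Line.ordinary 0 (K.mul s a) : K.Line) :=
      (hrow _ _).mpr (by simp [mem_def, Incident, K.mul_zero])
    obtain ⟨m, hm⟩ := hσ.1 (.vertical s)
    have h2 : σ (.affine s (K.mul s a)) ∈ m := (hm _).mpr rfl
    have h3 : .affine s 0 ∈ m := by rw [← hax, hm]; rfl
    have h4 : .slope b ∈ m := by rw [← hσ0, hm]; trivial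
    rcases m with ⟨k, d⟩ | d | _
    · simp only [mem_def, Incident] at h3 h4
      subst h4
      generalize σ (.affine s (K.mul s a)) = q at h1 h2 ⊢
      rcases q with ⟨x, y⟩ | m | _
      · simp only [mem_def, Incident, K.mul_zero, zero_add] at h1 h2
        subst h1
        congr 1
        refine K.eq_of_mul_eq_right hb ?_
        rw [K.add_mul, ← hst, h2, eq_comm, add_left_comm, ← h3, add_zero]
      · simp only [mem_def, Incident] at h1 h2
        exact (hb (h2.symm.trans h1)).elim
      · exact h1.elim
    · exact h4.elim
    · exact h3.elim
  have hca : σ (.slope a) ∈ (Line.infty : K.Line) := (hcen .infty trivial _).mpr trivial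
  obtain ⟨m, hm⟩ := hσ.1 (.ordinary a 0)
  have hm0 : .affine 0 0 ∈ m := by rw [← hax, hm]; simp [mem_def, Incident, K.zero_mul]
  have hma : σ (.slope a) ∈ m := (hm _).mpr rfl
  have hms : ∀ s t, K.mul s a = K.mul t b → .affine (s + t) (K.mul s a) ∈ m := fun s t hst => by
    rw [← key s t hst, hm]; simp [mem_def, Incident]
  rcases m with ⟨c, d⟩ | d | _
  · refine ⟨c, ?_⟩
    rintro y s t rfl ht
    have h1 := hms s t ht.symm
    simp only [mem_def, Incident, K.zero_mul, zero_add] at hm0 h1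
    rw [h1, ← hm0, add_zero]
  · -- if `(a)` goes to `(∞)`, then `R_a⁻¹ = -R_b⁻¹`
    exfalso
    obtain ⟨s, hs⟩ := exists_ne (0 : S)
    obtain ⟨t, ht, -⟩ := K.existsUnique_mul_right b (K.mul s a) hb
    have h1 := hms s t ht.symm
    simp only [mem_def, Incident] at hm0 h1
    obtain rfl : t = -s := (neg_eq_of_add_eq_zero_right (h1.trans hm0.symm)).symm
    refine hab (K.eq_of_mul_eq_left hs ?_)
    rw [K.mul_add, K.mul_zero, ← ht, K.neg_mul]
    exact neg_add_cancel _
  · exact hm0.elim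

/-- A collineation that moves `(∞)` makes one of the flags `((0, 0), x = 0)` and `((0), y = 0)`
transitive, so it forces the inverses of the multiplications by `a` and `b` to add up to the inverse
of a multiplication. -/
theorem exists_mul_of_apply_infty_ne (K : Presemifield S) (hK : ∀ x y, K.mul x y = K.mul y x)
    {φ : Equiv.Perm K.Point} (hφ : φ ∈ collineationGroup K.Point K.Line)
    (hinf : φ .infty ≠ .infty) {a b : S} (hb : b ≠ 0) (hab : a + b ≠ 0) :
    ∃ c, ∀ y s t, K.mul a s = y → K.mul b t = y → K.mul c (s + t) = y := by
  have flag : ∀ ψ ∈ collineationGroup K.Point K.Line, ∀ m : K.Line, ψ .infty ∈ m →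
      IsTransitiveFlag (ψ .infty) m := by
    intro ψ hψ m hm
    obtain ⟨l, hl⟩ := hψ.2 m
    have hl' : ∀ p, ψ p ∈ m ↔ p ∈ l := fun p => by simpa using (hl (ψ p)).symm
    exact (K.isTransitiveFlag_infty l ((hl' _).mp hm)).map hψ hl'
  rcases hP : φ .infty with ⟨u, v⟩ | s | _
  · have e : (K.shearTranslation (-u) (-v) 0 * φ) .infty = .affine 0 0 := by
      simp [Equiv.Perm.mul_apply, hP, K.mul_zero]
    have := flag _ (mul_mem (K.shearTranslation_mem_collineationGroup (-u) (-v) 0) hφ) (.vertical 0)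
      (by rw [e]; rfl)
    rw [e] at this
    exact K.exists_mul_left_of_isTransitiveFlag this hb hab
  · have e : (K.shearTranslation 0 0 (-s) * φ) .infty = .slope 0 := by
      simp [Equiv.Perm.mul_apply, hP]
    have := flag _ (mul_mem (K.shearTranslation_mem_collineationGroup 0 0 (-s)) hφ) (.ordinary 0 0)
      (by rw [e]; rfl)
    rw [e] at this
    obtain ⟨c, hc⟩ := K.exists_mul_right_of_isTransitiveFlag this hb hab
    refine ⟨c, fun y s t hs ht => ?_⟩
    rw [hK] at hs ht ⊢
    exact hc y s t hs ht
  · exact (hinf hP).elim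

/-! ### The order of a presemifield plane -/

instance [Finite S] (K : Presemifield S) : Finite K.Point :=
  Finite.of_injective
    (fun p : K.Point => match p with
      | .affine x y => (Sum.inl (x, y) : (S × S) ⊕ Option S)
      | .slope a => Sum.inr (some a)
      | .infty => Sum.inr none)
    (by rintro (⟨x, y⟩ | a | _) (⟨x', y'⟩ | a' | _) h <;> simp_all)

instance [Finite S] (K : Presemifield S) : Finite K.Line :=
  Finite.of_injective
    (fun l : K.Line => match l with
      | .ordinary a b => (Sum.inl (a, b) : (S × S) ⊕ Option S)
      | .vertical a => Sum.inr (some a)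
      | .infty => Sum.inr none)
    (by rintro (⟨x, y⟩ | a | _) (⟨x', y'⟩ | a' | _) h <;> simp_all)

theorem order_eq [Finite S] (K : Presemifield S) :
    ProjectivePlane.order K.Point K.Line = Nat.card S := by
  have h := ProjectivePlane.pointCount_eq K.Point (Line.infty : K.Line)
  let e : {p : K.Point // p ∈ (Line.infty : K.Line)} ≃ Option S :=
    { toFun := fun p => match p with
        | ⟨.slope a, _⟩ => some a
        | ⟨.infty, _⟩ => none
      invFun := fun o => match o with
        | some a => ⟨.slope a, trivial⟩
        | none => ⟨.infty, trivial⟩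
      left_inv := by
        rintro ⟨⟨x, y⟩ | a | _, hp⟩
        · exact hp.elim
        · rfl
        · rfl
      right_inv := by rintro (_ | a) <;> rfl }
  rw [pointCount, Nat.card_congr e, Finite.card_option] at h
  omega

end Presemifield

namespace KnuthBinary

variable {F : Type*} [Field F] [Algebra (ZMod 2) F]

/-! ### Arithmetic of the Knuth presemifield -/

theorem tr_zero : tr (0 : F) = 0 := by simp [tr]

/-- If `Tr(a) = 0`, then `a * s = y` is solved by `s = y / a + a Tr(y / a)`: left multiplication by
`a` differs from the field multiplication by an endomorphism of rank one. -/
theorem mul_div_add_mul_tr {a : F} (ha : a ≠ 0) (hta : tr a = 0) (y : F) :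
    mul a (y / a + a * tr (y / a)) = y := by
  have := charP_two F
  have h2 : (2 : F) = 0 := CharTwo.two_eq_zero
  rcases tr_eq (y / a) with h | h <;> rw [h]
  · rw [mul, MulZeroClass.mul_zero, add_zero, h, hta]
    field_simp
    ring
  · rw [mul, mul_one, tr_add, h, hta]
    have e : a * (y / a) = y := mul_div_cancel₀ y ha
    linear_combination e + a ^ 2 * h2

/-- Two trace conditions leave at least two nonzero elements of a field with at least 16
elements. -/
theorem exists_ne_tr_mul_eq_zero [Finite F] (n : ℕ) (hF : Nat.card F = 2 ^ n) (hn4 : 4 ≤ n)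
    (u v : F) : ∃ y₁ y₂ : F, y₁ ≠ 0 ∧ y₂ ≠ 0 ∧ y₁ ≠ y₂ ∧
      (tr (y₁ * u) = 0 ∧ tr (y₁ * v) = 0) ∧ tr (y₂ * u) = 0 ∧ tr (y₂ * v) = 0 := by
  have hfr : Module.finrank (ZMod 2) F = n := by
    have h2 := Module.natCard_eq_pow_finrank (K := ZMod 2) (V := F)
    rw [hF, Nat.card_zmod] at h2
    exact (Nat.pow_right_injective le_rfl h2).symm
  let T : F →ₗ[ZMod 2] ZMod 2 × ZMod 2 :=
    ((Algebra.trace (ZMod 2) F).comp (LinearMap.mulRight (ZMod 2) u)).prod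
      ((Algebra.trace (ZMod 2) F).comp (LinearMap.mulRight (ZMod 2) v))
  have hker : ∀ y ∈ LinearMap.ker T, tr (y * u) = 0 ∧ tr (y * v) = 0 := by
    intro y hy
    simpa [T, tr] using hy
  have hdim : 2 ≤ Module.finrank (ZMod 2) (LinearMap.ker T) := by
    have h1 := LinearMap.finrank_range_add_finrank_ker T
    have h2 : Module.finrank (ZMod 2) (LinearMap.range T) ≤ 2 := by
      simpa using Submodule.finrank_le (LinearMap.range T)
    omega
  have hcard : 4 ≤ (LinearMap.ker T : Set F).ncard := by
    have h := Module.natCard_eq_pow_finrank (K := ZMod 2) (V := LinearMap.ker T)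
    rw [Nat.card_zmod] at h
    have h' := Nat.pow_le_pow_right (n := 2) two_pos hdim
    rw [← h] at h'
    exact h'
  have hcard' : 1 < ((LinearMap.ker T : Set F) \ {0}).ncard := by
    rw [Set.ncard_sdiff_singleton_of_mem (zero_mem (LinearMap.ker T))]
    omega
  obtain ⟨y₁, y₂, h₁, h₂, hne⟩ := (Set.one_lt_ncard_iff (Set.toFinite _)).mp hcard'
  exact ⟨y₁, y₂, h₁.2, h₂.2, hne, hker _ h₁.1, hker _ h₂.1⟩

/-- For `a ≠ b` of trace `0`, the map `L_a⁻¹ + L_b⁻¹` is not the inverse of a left multiplication.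
It agrees with multiplication by `1 / a + 1 / b` on the `y` with `Tr(y / a) = Tr(y / b) = 0`; as
there are at least two such `y ≠ 0`, this determines `c` as `1 / c = 1 / a + 1 / b` and gives
`Tr(c) = 0`. Then the values at `y = a` do not match. -/
theorem not_exists_mul_add_eq [Finite F] (n : ℕ) (hF : Nat.card F = 2 ^ n) (hn4 : 4 ≤ n)
    (h1 : tr (1 : F) = 1) {a b : F} (ha : a ≠ 0) (hb : b ≠ 0) (hab : a ≠ b) (hta : tr a = 0)
    (htb : tr b = 0) :
    ¬ ∃ c : F, ∀ y s t, mul a s = y → mul b t = y → mul c (s + t) = y := by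
  have := charP_two F
  have h2 : (2 : F) = 0 := CharTwo.two_eq_zero
  rintro ⟨c, hc⟩
  have key : ∀ y, mul c ((y / a + a * tr (y / a)) + (y / b + b * tr (y / b))) = y := fun y =>
    hc y _ _ (mul_div_add_mul_tr ha hta y) (mul_div_add_mul_tr hb htb y)
  -- nonzero elements of the common kernel
  obtain ⟨y₁, y₂, hy₁, hy₂, hy, ⟨ha₁, hb₁⟩, ha₂, hb₂⟩ : ∃ y₁ y₂ : F, y₁ ≠ 0 ∧ y₂ ≠ 0 ∧ y₁ ≠ y₂ ∧
      (tr (y₁ / a) = 0 ∧ tr (y₁ / b) = 0) ∧ tr (y₂ / a) = 0 ∧ tr (y₂ / b) = 0 := by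
    simpa only [div_eq_mul_inv] using exists_ne_tr_mul_eq_zero n hF hn4 a⁻¹ b⁻¹
  have small : ∀ y, y ≠ 0 → tr (y / a) = 0 → tr (y / b) = 0 →
      c * (1 / a + 1 / b) + y * (1 / a + 1 / b) ^ 2 * tr c = 1 := by
    intro y hy hya hyb
    have h := key y
    rw [hya, hyb, mul, tr_add, tr_add] at h
    simp only [MulZeroClass.mul_zero, tr_zero, hya, hyb, add_zero] at h
    refine mul_left_cancel₀ hy ?_
    rcases tr_eq c with h0 | h0 <;> rw [h0] at h ⊢ <;> linear_combination h
  have e₁ := small y₁ hy₁ ha₁ hb₁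
  have e₂ := small y₂ hy₂ ha₂ hb₂
  have hd : 1 / a + 1 / b ≠ 0 := by
    intro h
    refine hab ?_
    field_simp at h
    linear_combination h - b * h2
  have htc : tr c = 0 := by
    have h : (y₁ - y₂) * ((1 / a + 1 / b) ^ 2 * tr c) = 0 := by linear_combination e₁ - e₂
    exact (mul_eq_zero.mp ((mul_eq_zero.mp h).resolve_left (sub_ne_zero.mpr hy))).resolve_left
      (pow_ne_zero 2 hd)
  have hcd : c * (1 / a + 1 / b) = 1 := by rw [htc] at e₁; linear_combination e₁
  have hc0 : c ≠ 0 := by rintro rfl; simp at hcd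
  have hcd' : c * (1 + a / b) = a := by
    field_simp at hcd ⊢
    linear_combination hcd
  have h := key a
  rw [div_self ha, h1, mul_one] at h
  rcases tr_eq (a / b) with h0 | h0
  · rw [h0, MulZeroClass.mul_zero, add_zero, mul, htc, tr_add, tr_add, h1, h0, hta] at h
    -- here `h` reduces to `c (a + c) = 0`, so `c = a` and `1 / b = 0`
    have h3 : c * (a + c) = 0 := by
      linear_combination h - hcd'
    have h4 := (mul_eq_zero.mp h3).resolve_left hc0
    obtain rfl : a = c := by linear_combination h4 - c * h2
    have h5 : a * (1 / b) = 0 := by linear_combination hcd - div_self ha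
    exact (mul_ne_zero ha (one_div_ne_zero hb)) h5
  · rw [h0, mul_one, mul, htc, tr_add, tr_add, tr_add, h1, h0, hta, htb] at h
    have h3 : c * (a + b) = 0 := by
      linear_combination h - hcd' - 2 * c ^ 2 * h2
    have h4 := (mul_eq_zero.mp h3).resolve_left hc0
    exact hab (by linear_combination h4 - b * h2)

end KnuthBinary

namespace KnuthBinary

variable {F : Type*} [Field F] [Algebra (ZMod 2) F]

theorem tr_sq_add_self [Finite F] (x : F) : tr (x ^ 2 + x) = 0 := by
  have := charP_two F
  rw [tr_add, tr_sq, CharTwo.add_self_eq_zero]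

theorem add_mul (x y z : F) : mul (x + y) z = mul x z + mul y z := by
  rw [mul_comm, mul_add, mul_comm z x, mul_comm z y]

/-- As `Tr(u² + u) = 0`, one of the two summands under the square vanishes. -/
theorem mul_sq_add_self [Finite F] (u a : F) :
    mul (u ^ 2 + u) a = (u ^ 2 + u) * a + (u ^ 2 + u) ^ 2 * tr a := by
  rw [mul, tr_sq_add_self]
  rcases tr_eq a with h | h <;> rw [h] <;> ring

/-- The additive map `u ↦ (u² + u) * a - u` has at most one nonzero root. For `Tr(a) = 1` two nonzero
roots `u ≠ v` satisfy `1 / (u + 1) = (v / u)² + v / u`, so `Tr(1 / (u + 1)) = 0`; but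
`a = 1 / (u + 1) + u² + u`, so `Tr(1 / (u + 1)) = Tr(a)`. -/
theorem eq_of_mul_sq_add_self_eq [Finite F] {a u v : F} (hu : u ≠ 0) (hv : v ≠ 0)
    (h : mul (u ^ 2 + u) a = u) (h' : mul (v ^ 2 + v) a = v) : u = v := by
  have := charP_two F
  have h2 : (2 : F) = 0 := CharTwo.two_eq_zero
  rw [mul_sq_add_self] at h h'
  have e : (u + 1) * (a + (u ^ 2 + u) * tr a) = 1 :=
    mul_left_cancel₀ hu (by linear_combination h)
  have e' : (v + 1) * (a + (v ^ 2 + v) * tr a) = 1 :=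
    mul_left_cancel₀ hv (by linear_combination h')
  rcases tr_eq a with ha | ha
  · rw [ha] at e e'
    have ha0 : a ≠ 0 := by rintro rfl; simp at e
    exact mul_right_cancel₀ ha0 (by linear_combination e - e')
  · rw [ha] at e e'
    by_contra hne
    have hu1 : u + 1 ≠ 0 := by rintro h0; simp [h0] at e
    have h3 : (u + v + 1) * ((u + 1) * (v + 1)) = 1 := by
      refine mul_left_cancel₀ (sub_ne_zero.mpr hne) ?_
      linear_combination (v + 1) * e - (u + 1) * e' + (v - u) * h2
    have h4 : 1 / (u + 1) = (v / u) ^ 2 + v / u := by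
      field_simp
      linear_combination -h3 + (u ^ 2 + u * v + u + v) * h2
    have h5 : a = 1 / (u + 1) + (u ^ 2 + u) := by
      field_simp
      linear_combination e - (u + 1) * (u ^ 2 + u) * h2
    have h6 := congrArg tr h5
    rw [tr_add, tr_sq_add_self, h4, tr_sq_add_self, ha] at h6
    simp at h6

theorem eq_zero_of_mul_sq_add_self_one [Finite F] (h1 : tr (1 : F) = 1) {u : F}
    (h : mul (u ^ 2 + u) 1 = u) : u = 0 := by
  have := charP_two F
  have h2 : (2 : F) = 0 := CharTwo.two_eq_zero
  rw [mul_sq_add_self, h1] at h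
  have : u ^ 4 = 0 := by linear_combination h - (u ^ 3 + u ^ 2) * h2
  simpa using this

theorem mul_sq_add_self_of_mem_line {a b y z : F} (hy : y = mul (y ^ 2 + y) a + b)
    (hz : z = mul (z ^ 2 + z) a + b) : mul ((y + z) ^ 2 + (y + z)) a = y + z := by
  have := charP_two F
  have h2 : (2 : F) = 0 := CharTwo.two_eq_zero
  have e : (y + z) ^ 2 + (y + z) = (y ^ 2 + y) + (z ^ 2 + z) := by
    linear_combination y * z * h2
  rw [e, add_mul]
  linear_combination -hy - hz - b * h2

end KnuthBinary

open Configuration Presemifield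

/-! ### The set `{(y² + y, y)} ∪ {(0), (1)}` is a translation hyperoval -/

namespace KnuthBinary

theorem ncard_quadraticSet {F : Type*} [Field F] [Finite F] (K : Presemifield F) :
    (quadraticSet K).ncard = Nat.card F + 2 := by
  rw [quadraticSet, Set.ncard_union_eq, Set.ncard_pair (by simp), ← Set.image_univ,
    Set.ncard_image_of_injective _ (fun y z h => by simpa using (Point.affine.inj h).2),
    Set.ncard_univ]
  rw [Set.disjoint_left]
  rintro _ ⟨y, rfl⟩
  simp

variable {F : Type*} [Field F] [Algebra (ZMod 2) F]

/-- The translations by `(t² + t, t)`, as a homomorphism from the additive group of the field; it is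
one because squaring is additive. -/
def quadraticTranslation (K : Presemifield F) : Multiplicative F →* Equiv.Perm K.Point :=
  MonoidHom.mk' (fun t => K.shearTranslation (t.toAdd ^ 2 + t.toAdd) t.toAdd 0) <| by
    have := charP_two F
    intro s t
    ext p
    rcases p with ⟨x, y⟩ | m | _
    · have e : (s.toAdd + t.toAdd) ^ 2 = s.toAdd ^ 2 + t.toAdd ^ 2 := add_pow_char _ _ 2
      simp only [toAdd_mul, shearTranslation_affine, Equiv.Perm.mul_apply, K.mul_zero, add_zero, e,
        Point.affine.injEq]
      constructor <;> ring
    · simp [Equiv.Perm.mul_apply]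
    · simp [Equiv.Perm.mul_apply]

theorem quadraticTranslation_apply (K : Presemifield F) (t y : F) :
    quadraticTranslation K (.ofAdd t) (.affine (y ^ 2 + y) y) =
      .affine ((y + t) ^ 2 + (y + t)) (y + t) := by
  have := charP_two F
  have e : (y + t) ^ 2 = y ^ 2 + t ^ 2 := add_pow_char _ _ 2
  change K.shearTranslation (t ^ 2 + t) t 0 _ = _
  simp only [shearTranslation_affine, K.mul_zero, e, Point.affine.injEq]
  constructor <;> ring

variable [Finite F] (n : ℕ) (hn : Odd n) (hF : Nat.card F = 2 ^ n)

theorem isHyperoval_quadraticSet :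
    IsHyperoval (presemifield F n hn hF).Line (quadraticSet (presemifield F n hn hF)) := by
  have := charP_two F
  have h2 : (2 : F) = 0 := CharTwo.two_eq_zero
  have h1 := tr_one n hn hF
  refine ⟨by rw [ncard_quadraticSet, order_eq], ?_⟩
  have hadd : ∀ y z : F, y ≠ z → y + z ≠ 0 := fun y z h h0 =>
    h (by linear_combination h0 - z * h2)
  -- three affine points
  have aff : ∀ (l : (presemifield F n hn hF).Line) (x y z : F), x ≠ y → x ≠ z → y ≠ z →
      .affine (x ^ 2 + x) x ∈ l → .affine (y ^ 2 + y) y ∈ l → .affine (z ^ 2 + z) z ∈ l →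
      False := by
    rintro (⟨a, b⟩ | c | _) x y z hxy hxz hyz hx hy hz
    · have := eq_of_mul_sq_add_self_eq (hadd x y hxy) (hadd x z hxz)
        (mul_sq_add_self_of_mem_line hx hy) (mul_sq_add_self_of_mem_line hx hz)
      exact hyz (add_left_cancel this)
    · simp only [mem_def, Incident] at hx hy hz
      have e : ∀ w, w ≠ x → w ^ 2 + w = c → x + w = 1 := fun w hw h =>
        mul_left_cancel₀ (hadd x w hw.symm)
          (by linear_combination hx - h + (w ^ 2 + x * w - x) * h2)
      exact hyz (add_left_cancel ((e y hxy.symm hy).trans (e z hxz.symm hz).symm))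
    · exact hx
  -- two affine points and a point at infinity
  have inf : ∀ (l : (presemifield F n hn hF).Line) (c y z : F), c = 0 ∨ c = 1 → y ≠ z →
      .slope c ∈ l → .affine (y ^ 2 + y) y ∈ l → .affine (z ^ 2 + z) z ∈ l → False := by
    rintro (⟨a, b⟩ | d | _) c y z hc hyz h hy hz
    · obtain rfl : c = a := h
      have e := mul_sq_add_self_of_mem_line hy hz
      refine hadd y z hyz ?_
      rcases hc with rfl | rfl
      · rw [mul_sq_add_self, tr_zero] at e
        linear_combination -e
      · exact eq_zero_of_mul_sq_add_self_one h1 e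
    · exact h
    · exact hy
  -- one affine point and two points at infinity
  have two : ∀ (l : (presemifield F n hn hF).Line) (c d x y : F), c ≠ d →
      .slope c ∈ l → .slope d ∈ l → .affine x y ∈ l → False := by
    rintro (⟨a, b⟩ | e | _) c d x y hcd hc hd h
    · exact hcd (hc.trans hd.symm)
    · exact hc
    · exact h
  rintro _ (⟨x, rfl⟩ | rfl | rfl) _ (⟨y, rfl⟩ | rfl | rfl) _ (⟨z, rfl⟩ | rfl | rfl) h₁₂ h₁₃ h₂₃
    ⟨l, hl₁, hl₂, hl₃⟩ <;> first
    | exact h₁₂ rfl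
    | exact h₁₃ rfl
    | exact h₂₃ rfl
    | exact aff l x y z (by rintro rfl; exact h₁₂ rfl) (by rintro rfl; exact h₁₃ rfl)
        (by rintro rfl; exact h₂₃ rfl) hl₁ hl₂ hl₃
    | exact inf l _ _ _ (by simp) (by rintro rfl; exact h₂₃ rfl) hl₁ hl₂ hl₃
    | exact inf l _ _ _ (by simp) (by rintro rfl; exact h₁₃ rfl) hl₂ hl₁ hl₃
    | exact inf l _ _ _ (by simp) (by rintro rfl; exact h₁₂ rfl) hl₃ hl₁ hl₂
    | exact two l _ _ _ _ zero_ne_one hl₁ hl₂ hl₃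
    | exact two l _ _ _ _ zero_ne_one hl₂ hl₁ hl₃
    | exact two l _ _ _ _ zero_ne_one hl₁ hl₃ hl₂
    | exact two l _ _ _ _ zero_ne_one hl₃ hl₁ hl₂
    | exact two l _ _ _ _ zero_ne_one hl₂ hl₃ hl₁
    | exact two l _ _ _ _ zero_ne_one hl₃ hl₂ hl₁

theorem isTranslationHyperoval_quadraticSet :
    IsTranslationHyperoval (Line.infty : (presemifield F n hn hF).Line)
      (quadraticSet (presemifield F n hn hF)) := by
  set K := presemifield F n hn hF
  have haff : ∀ p ∈ quadraticSet K, p ∉ (Line.infty : K.Line) →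
      ∃ y, p = .affine (y ^ 2 + y) y := by
    rintro _ (⟨y, rfl⟩ | rfl | rfl) hp
    · exact ⟨y, rfl⟩
    · exact (hp trivial).elim
    · exact (hp trivial).elim
  refine ⟨isHyperoval_quadraticSet n hn hF, ?_, (quadraticTranslation K).range, ?_, ?_, ?_, ?_⟩
  · rw [← Set.ncard_pair (show (.slope 0 : K.Point) ≠ .slope 1 by simp)]
    congr 1
    ext p
    constructor
    · rintro ⟨⟨y, rfl⟩ | h, hp⟩
      · exact hp.elim
      · exact h
    · rintro (rfl | rfl)
      · exact ⟨Or.inr (Or.inl rfl), trivial⟩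
      · exact ⟨Or.inr (Or.inr rfl), trivial⟩
  · rintro _ ⟨t, rfl⟩
    exact K.isTranslation_shearTranslation _ _
  · have hinj : Function.Injective (quadraticTranslation K) := by
      intro s t h
      have h0 := congrArg (fun σ : Equiv.Perm K.Point => σ (.affine (0 ^ 2 + 0) 0)) h
      have h1 := (quadraticTranslation_apply K s.toAdd 0).symm.trans
        (h0.trans (quadraticTranslation_apply K t.toAdd 0))
      simpa using (Point.affine.inj h1).2
    rw [order_eq, ← Nat.card_congr (MonoidHom.ofInjective hinj).toEquiv]
    exact Nat.card_congr Multiplicative.toAdd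
  · rintro _ ⟨t, rfl⟩ p hp hp'
    obtain ⟨y, rfl⟩ := haff p hp hp'
    rw [← ofAdd_toAdd t, quadraticTranslation_apply]
    exact ⟨Or.inl ⟨_, rfl⟩, id⟩
  · intro p hp hpl p' hp' hpl'
    obtain ⟨y, rfl⟩ := haff p hp hpl
    obtain ⟨z, rfl⟩ := haff p' hp' hpl'
    refine ⟨quadraticTranslation K (.ofAdd (z - y)), ⟨⟨_, rfl⟩, ?_⟩, ?_⟩
    · rw [quadraticTranslation_apply, add_sub_cancel]
    · rintro _ ⟨⟨t, rfl⟩, h⟩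
      rw [← ofAdd_toAdd t, quadraticTranslation_apply] at h
      rw [← (Point.affine.inj h).2, add_sub_cancel_left, ofAdd_toAdd]

/-! ### Inequivalence with the standard hyperoval -/

/-- For `n ≥ 4`, every collineation fixes `(∞)`. The bound is needed: for `n = 1` the plane has
order `2`, and its collineation group is transitive on the points. -/
theorem apply_infty_eq (hn4 : 4 ≤ n) {φ : Equiv.Perm (presemifield F n hn hF).Point}
    (hφ : φ ∈ collineationGroup _ (presemifield F n hn hF).Line) : φ .infty = .infty := by
  have := charP_two F
  by_contra hinf
  obtain ⟨a, b, ha, hb, hab, ⟨hta, -⟩, htb, -⟩ := exists_ne_tr_mul_eq_zero n hF hn4 (1 : F) 1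
  rw [_root_.mul_one] at hta htb
  exact not_exists_mul_add_eq n hF hn4 (tr_one n hn hF) ha hb hab hta htb
    ((presemifield F n hn hF).exists_mul_of_apply_infty_ne mul_comm hφ hinf hb
      (fun h => hab (CharTwo.add_eq_zero.mp h)))

end KnuthBinary

theorem mainTheorem1 (n : ℕ) (hn : Odd n)
    (F : Type*) [Field F] [Finite F] [Algebra (ZMod 2) F] (hF : Nat.card F = 2 ^ n) :
    Configuration.IsTranslationHyperoval
        (Presemifield.Line.infty : (KnuthBinary.presemifield F n hn hF).Line)
        (quadraticSet (KnuthBinary.presemifield F n hn hF)) ∧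
      (5 ≤ n →
        ¬ Configuration.AreEquivalent (KnuthBinary.presemifield F n hn hF).Line
          (quadraticSet (KnuthBinary.presemifield F n hn hF))
          (standardHyperoval (KnuthBinary.presemifield F n hn hF))) := by
  refine ⟨KnuthBinary.isTranslationHyperoval_quadraticSet n hn hF, ?_⟩
  rintro hn5 ⟨φ, hφ, hO⟩
  have hinf := KnuthBinary.apply_infty_eq n hn hF (by omega) hφ
  -- `(∞)` belongs to the standard hyperoval only
  have h : (Point.infty : (KnuthBinary.presemifield F n hn hF).Point) ∈
      φ '' quadraticSet (KnuthBinary.presemifield F n hn hF) := by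
    rw [hO]; exact Or.inr (Or.inr rfl)
  obtain ⟨p, hp, hpinf⟩ := h
  obtain rfl := φ.injective (hpinf.trans hinf.symm)
  rcases hp with ⟨y, hy⟩ | hp
  · cases hy
  · simp at hp
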